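/- **Conventions.** Consider the triangular grid as the projection of the cubical tessellation of $\mathbb{R}^3$ along the direction $(1,1,1)$: unit squares project to lozenges (unions of two adjacent unit triangles) and unit cubes project to unit hexagons. A tiling of a finite union $\mathcal D$ of triangles of the grid is a set of lozenges with pairwise disjoint interiors and union $\mathcal D$. The unit hexagon has two tilings by three lozenges; a down-flip replaces, inside a tiling, the one in which the three upper faces of a cube are seen by the one in which the three lower faces are seen. A pile is a finite set of unit cubes in the octant $\mathbb{Z}_{\ge 0}^3$, a cube being encoded by its lowest corner. A pile is *compact* if for each of its cubes $(i_0,j_0,k_0)$ it contains all cubes $(i,j_0,k_0)$, $(i_0,j,k_0)$, $(i_0,j_0,k)$ with $0\le i\le i_0$, $0\le j\le j_0$, $0\le k\le k_0$. A *pseudo-hexagon* $\mathcal D$ is the domain obtained by starting from a compact pile, viewed from the direction $(1,1,1)$, and performing all possible down-flips. A pile is *in* $\mathcal D$ if all its cubes project into $\mathcal D$. It is put on the base squares, i.e. the squares of the three coordinate planes of the octant that project into $\mathcal D$. The pile *corresponds* to a tiling $T$ of $\mathcal D$ if the uncovered squares (those faces of cubes of the pile which look in a positive axis direction and are not shared with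 another cube of the pile, and the base squares on which no cube of the pile stands) are projected one-to-one onto the lozenges of $T$. A plane partition is a filling of a Ferrers diagram with positive integers that is non-increasing along rows and columns; $A\le B$ means $A_{ij}\le B_{ij}$ for all $i,j$, with entries outside the diagram counted as $0$. The pile of $A$ is $\{(i,j,k): 0\le k<A_{ij}\}$. **Proposition.** Let $\mathcal D$ be a pseudo-hexagon. 1. A pile of cubes in $\mathcal D$ corresponds to a tiling of $\mathcal D$ if and only if it is compact. 2. A pile is compact if and only if every section of it by a plane orthogonal to one of the axes is a (possibly empty) Ferrers diagram. 3. The empty pile corresponds to a tiling of $\mathcal D$ on which no down-flip is possible. 4. There is a plane partition $B$ whose pile defines $\mathcal D$ as a pseudo-hexagon and is the greatest compact pile in $\mathcal D$. Taking piles is a bijection from the plane partitions $A\le B$ onto the compact piles in $\mathcal D$, and there is a bijection from the plane partitions $A\le B$ onto the tilings of $\mathcal D$ under which the pile of $A$ corresponds to the tiling assigned to $A$. -/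

import Mathlib

namespace LozengeTiling

/-! ### The triangular grid and lozenges

The vertices of the triangular grid are the points of `ℤ × ℤ`, the coordinates being taken with
respect to two unit vectors `a`, `b` at an angle of 120 degrees; `c = -a-b` is the third unit vector
of the grid with `a + b + c = 0`. -/

/-- The three positive directions `a`, `b`, `c` of the triangular grid: the projections along
`(1,1,1)` of the three unit vectors of `ℤ³`. -/
def dir : Fin 3 → ℤ × ℤ := ![(1, 0), (0, 1), (-1, -1)]

/-- The unit triangles of the grid, of both orientations. -/
inductive Triangle where
  | up (v : ℤ × ℤ)
  | down (v : ℤ × ℤ)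

/-- The vertices of a triangle: `v, v + a, v + a + b` and `v, v + b, v + a + b`. -/
def Triangle.vertices : Triangle → Set (ℤ × ℤ)
  | .up v => {v, v + (1, 0), v + (1, 1)}
  | .down v => {v, v + (0, 1), v + (1, 1)}

/-- The lozenge with vertices `v`, `v + e`, `v + f`, `v + e + f`, where `v` is the corner and `e`,
`f` are the two positive directions other than `dir axis`. There are three kinds of lozenges,
one for each value of `axis`. -/
@[ext] structure Lozenge where
  axis : Fin 3
  corner : ℤ × ℤ

/-- The two triangles that a lozenge is made of. -/
def Lozenge.cells (l : Lozenge) : Set Triangle :=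
  match l.axis with
  | 0 => {.up (l.corner - (1, 0)), .down (l.corner - (1, 1))}
  | 1 => {.up (l.corner - (1, 1)), .down (l.corner - (0, 1))}
  | 2 => {.up l.corner, .down l.corner}

/-- The triangles of a lozenge are `v, v + e, v + e + f` and `v, v + f, v + e + f`. -/
theorem Lozenge.vertices_cells (k : Fin 3) (v : ℤ × ℤ) :
    Triangle.vertices '' (Lozenge.mk k v).cells =
      {{v, v + dir (k + 1), v + dir (k + 1) + dir (k + 2)},
        {v, v + dir (k + 2), v + dir (k + 1) + dir (k + 2)}} := by
  obtain ⟨x, y⟩ := v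
  fin_cases k
  · simp only [Lozenge.cells, Set.image_pair, Triangle.vertices, dir]
    congr 1
    · ext ⟨s, t⟩; simp; grind
    · congr 1; ext ⟨s, t⟩; simp; grind
  · simp only [Lozenge.cells, Set.image_pair, Triangle.vertices, dir]
    congr 1
    · ext ⟨s, t⟩; simp; grind
    · congr 1; ext ⟨s, t⟩; simp; grind
  · simp only [Lozenge.cells, Set.image_pair, Triangle.vertices, dir]
    congr 1
    · ext ⟨s, t⟩; simp
    · congr 1; ext ⟨s, t⟩; simp

/-- The part of the plane (as a set of triangles) covered by a set of lozenges. -/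
def region (T : Set Lozenge) : Set Triangle := ⋃ l ∈ T, l.cells

/-- `T` is a tiling of the domain `D` (a set of triangles): its lozenges have pairwise disjoint
interiors, and their union is `D`. -/
def IsTiling (D : Set Triangle) (T : Set Lozenge) : Prop :=
  T.PairwiseDisjoint Lozenge.cells ∧ region T = D

/-- `T'` is obtained from `T` by a down-flip: three lozenges of `T` that cover the unit hexagon
with centre `v`, all edges at `v` being directed towards `v` (so that the height is maximal at `v`),
are replaced by the three lozenges of the other tiling of that hexagon, where all edges at `v` are
directed away from `v`. -/
def DownFlip (T T' : Set Lozenge) : Prop :=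
  ∃ v : ℤ × ℤ, (∀ k, (⟨k, v + dir k⟩ : Lozenge) ∈ T) ∧
    T' = (T \ Set.range fun k => (⟨k, v + dir k⟩ : Lozenge)) ∪
      Set.range fun k => (⟨k, v⟩ : Lozenge)

/-! ### Cubes, squares, and their projections -/

/-- A unit cube of the cubical tessellation of the positive octant, given by its lowest corner. -/
abbrev Cube := Fin 3 → ℕ

/-- A unit square (2-cell) of the cubical tessellation: the square orthogonal to the axis `axis`
whose lowest corner is `corner`. -/
@[ext] structure Square where
  axis : Fin 3
  corner : Fin 3 → ℕ

/-- The projection along `(1,1,1)` onto the triangular grid. -/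
def proj (p : Fin 3 → ℕ) : ℤ × ℤ := ((p 0 : ℤ) - p 2, (p 1 : ℤ) - p 2)

/-- The projection of a square along `(1,1,1)`, a lozenge. -/
def Square.toLozenge (s : Square) : Lozenge := ⟨s.axis, proj s.corner⟩

/-- The projection of a cube along `(1,1,1)`: a unit hexagon, covered by the projections of the
three lower faces of the cube. -/
def hexagon (p : Cube) : Set Triangle :=
  region (Set.range fun k => (⟨k, p⟩ : Square).toLozenge)

/-- A pile is a set of cubes. It is compact if with every cube it contains all the cubes between
that cube and the coordinate planes, in the three directions of the axes. -/
def IsCompactPile (P : Set Cube) : Prop :=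
  ∀ p ∈ P, ∀ k : Fin 3, ∀ i ≤ p k, Function.update p k i ∈ P

/-- The faces of a pile that look in the directions of the axes and are not covered by
a cube of the pile: `p + Pi.single k 1` is the next cube after `p` in the direction `k`, and also
the lowest corner of the square between the two. -/
def visibleFaces (P : Set Cube) : Set Square :=
  {s | ∃ p ∈ P, s.corner = p + Pi.single s.axis 1 ∧ s.corner ∉ P}

/-- `D` is the domain obtained from the finite compact pile `Q` (seen from the direction `(1,1,1)`)
by performing all the possible down-flips. -/
def IsPseudoHexagonOf (Q : Set Cube) (D : Set Triangle) : Prop :=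
  Q.Finite ∧ IsCompactPile Q ∧ ∃ T₀ : Set Lozenge,
    Relation.ReflTransGen DownFlip (Square.toLozenge '' visibleFaces Q) T₀ ∧
    (∀ T', ¬ DownFlip T₀ T') ∧ D = region T₀

/-- A pseudo-hexagon. -/
def IsPseudoHexagon (D : Set Triangle) : Prop := ∃ Q : Set Cube, IsPseudoHexagonOf Q D

/-- `P` is a (finite) pile of cubes in the domain `D`. -/
def IsPileIn (D : Set Triangle) (P : Set Cube) : Prop :=
  P.Finite ∧ ∀ p ∈ P, hexagon p ⊆ D

/-- The base squares of a pseudo-hexagon, on which cubes can be put: the squares of the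
three coordinate planes of the octant that project into the domain. -/
def baseSquares (D : Set Triangle) : Set Square :=
  {s | s.corner s.axis = 0 ∧ s.toLozenge.cells ⊆ D}

/-- The squares that remain uncovered when the pile `P` is put on the base squares of `D`: those
faces of the pile, and those base squares, on which no cube of the pile stands. -/
def surface (D : Set Triangle) (P : Set Cube) : Set Square :=
  visibleFaces P ∪ {s ∈ baseSquares D | s.corner ∉ P}

/-- The pile `P` corresponds to the set of lozenges `T`: projecting the uncovered squares along
`(1,1,1)` gives exactly the lozenges of `T`, each of them once. -/
def CorrespondsTo (D : Set Triangle) (P : Set Cube) (T : Set Lozenge) : Prop :=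
  Set.BijOn Square.toLozenge (surface D P) T

/-! ### Ferrers diagrams and plane partitions -/

/-- `S` is the Ferrers diagram of a partition `l`, that is, of a non-increasing list of positive
integers: row `i` consists of the squares `(i, 0), …, (i, lᵢ - 1)`. -/
def IsFerrersDiagram (S : Set (ℕ × ℕ)) : Prop :=
  ∃ l : List ℕ, l.Pairwise (· ≥ ·) ∧ (∀ x ∈ l, 0 < x) ∧ S = {c | c.2 < l.getD c.1 0}

/-- The section of a pile by a plane orthogonal to the axis `k` (through the layer of cubes
whose `k`-th coordinate is `n`). -/
def layer (P : Set Cube) (k : Fin 3) (n : ℕ) : Set (ℕ × ℕ) :=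
  {c | ∃ p ∈ P, p k = n ∧ p (k + 1) = c.1 ∧ p (k + 2) = c.2}

/-- A plane partition: a filling of a Ferrers diagram with positive integers, non-increasing
along the rows and the columns. Outside its diagram it is extended by zero. -/
structure PlanePartition where
  shape : Set (ℕ × ℕ)
  shape_ferrers : IsFerrersDiagram shape
  entry : ℕ → ℕ → ℕ
  entry_pos : ∀ i j, (i, j) ∈ shape → 0 < entry i j
  entry_zero : ∀ i j, (i, j) ∉ shape → entry i j = 0
  row_le : ∀ i j j', (i, j) ∈ shape → (i, j') ∈ shape → j ≤ j' → entry i j' ≤ entry i j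
  col_le : ∀ i i' j, (i, j) ∈ shape → (i', j) ∈ shape → i ≤ i' → entry i' j ≤ entry i j

/-- The order on plane partitions, entry by entry: `A` is bounded by `B`. -/
def PlanePartition.BoundedBy (A B : PlanePartition) : Prop :=
  ∀ i j, A.entry i j ≤ B.entry i j

/-- The pile of cubes of a plane partition: a column of `A.entry i j` cubes on the square `(i, j)`
of the horizontal coordinate plane. -/
def PlanePartition.pile (A : PlanePartition) : Set Cube :=
  {p | p 2 < A.entry (p 0) (p 1)}

end LozengeTiling

/-!
A tiling of the plane lifts to a stepped surface in `ℤ³`, described by its height function on the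
vertices of the grid. The pseudo-hexagon of a compact pile `Q` is the part of the plane covered by
`Q`, since flips do not change the region. Outside of it one sees the walls of the octant, and
adding these wall squares to a tiling of the pseudo-hexagon gives a tiling of the plane. The height
of its surface above the walls is constant on each wall away from `Q`, and it is the same constant
on the three walls because any two of them share an axis; normalized to be zero there, the surface
is that of a compact pile, namely of the cubes below it. Thus tilings are the same as compact piles
in the domain, and these are the compact subsets of the pile of all cubes whose projections to the
three walls lie in `Q`.

Conversely, if a pile contains a cube but not its predecessor in some direction, take a triangle
covered by the face between the two. Looking along `(1,1,1)` at this triangle, one sees one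
uncovered square above the face and another one not above the missing cube, so the projection is not
one-to-one onto a tiling.

Removing a maximal cube from a compact pile is a down-flip, so down-flips lead from any compact pile
to the empty one. On its tiling no down-flip is possible, because every vertex is the corner of a
lozenge lying in a wall.
-/

namespace LozengeTiling

/-! ### Tilings of the plane and height functions -/

/-- The third coordinate of the `k`-th unit vector of `ℤ³`: the amount by which the height grows
along an edge of the grid in the direction `dir k` when this edge lifts to an edge of a cube. -/
def rise (k : Fin 3) : ℤ := if k = 2 then 1 else 0

/-- The height functions of the tilings of the plane. The height of a vertex is the third coordinate
of the point over it on a stepped surface in `ℤ³`: along an edge of the grid it grows by `rise`, or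
by one less if the edge is the diagonal of a lozenge (`IsHeightFunction.le_add_dir`). -/
def IsHeightFunction (z : ℤ × ℤ → ℤ) : Prop := ∀ v k, z (v + dir k) ≤ z v + rise k

/-- The tiling of the plane with the height function `z`. The diagonal of a lozenge that ends at
its corner is the only edge of the grid inside the lozenge, so a lozenge belongs to the tiling if
the height grows by less than `rise` along this diagonal. -/
def heightTiling (z : ℤ × ℤ → ℤ) : Set Lozenge :=
  {l | z l.corner < z (l.corner - dir l.axis) + rise l.axis}

/-- The increment along the edge from `v` to `v + dir k` of a height function of `T`. -/
noncomputable def increment (T : Set Lozenge) (k : Fin 3) (v : ℤ × ℤ) : ℤ :=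
  rise k - T.indicator 1 (⟨k, v + dir k⟩ : Lozenge)

theorem isTiling_iff {D : Set Triangle} {T : Set Lozenge} :
    IsTiling D T ↔ (∀ l ∈ T, l.cells ⊆ D) ∧ ∀ t ∈ D, ∃! l, l ∈ T ∧ t ∈ l.cells := by
  constructor
  · rintro ⟨hd, rfl⟩
    refine ⟨fun l hl => Set.subset_biUnion_of_mem (u := Lozenge.cells) hl, fun t ht => ?_⟩
    obtain ⟨l, hl, htl⟩ := Set.mem_iUnion₂.1 ht
    exact ⟨l, ⟨hl, htl⟩, fun l' h' => hd.elim_set h'.1 hl t h'.2 htl⟩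
  · rintro ⟨hsub, hunique⟩
    refine ⟨fun l hl l' hl' hne => Set.disjoint_left.2 fun t ht ht' => hne ?_, ?_⟩
    · exact (hunique t (hsub l hl ht)).unique ⟨hl, ht⟩ ⟨hl', ht'⟩
    · refine Set.Subset.antisymm (Set.iUnion₂_subset hsub) fun t ht => ?_
      obtain ⟨l, hl, -⟩ := hunique t ht
      exact Set.mem_iUnion₂.2 ⟨l, hl.1, hl.2⟩

theorem Lozenge.up_mem_cells {l : Lozenge} {v : ℤ × ℤ} :
    Triangle.up v ∈ l.cells ↔
      l = ⟨0, v + dir 0⟩ ∨ l = ⟨1, v + dir 0 + dir 1⟩ ∨ l = ⟨2, v⟩ := by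
  obtain ⟨k, w⟩ := l
  obtain ⟨x, y⟩ := v
  obtain ⟨s, t⟩ := w
  fin_cases k <;> simp [Lozenge.cells, dir] <;> omega

theorem Lozenge.down_mem_cells {l : Lozenge} {v : ℤ × ℤ} :
    Triangle.down v ∈ l.cells ↔
      l = ⟨1, v + dir 1⟩ ∨ l = ⟨0, v + dir 1 + dir 0⟩ ∨ l = ⟨2, v⟩ := by
  obtain ⟨k, w⟩ := l
  obtain ⟨x, y⟩ := v
  obtain ⟨s, t⟩ := w
  fin_cases k <;> simp [Lozenge.cells, dir] <;> omega

theorem dir_cycle (v : ℤ × ℤ) : v + dir 0 + dir 1 + dir 2 = v := by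
  ext <;> simp [dir]

theorem dir_cycle' (v : ℤ × ℤ) : v + dir 1 + dir 0 + dir 2 = v := by
  rw [add_right_comm v, dir_cycle]

theorem exists_dir_add_dir_add_dir_eq_zero :
    ∀ {j k : Fin 3}, j ≠ k →
      ∃ i, dir j + dir k + dir i = 0 ∧ rise j + rise k + rise i = 1 := by
  decide

theorem existsUnique_mem_three_iff {α : Type*} {T : Set α} {a b c : α} (hab : a ≠ b)
    (hac : a ≠ c) (hbc : b ≠ c) :
    (∃! l, l ∈ T ∧ (l = a ∨ l = b ∨ l = c)) ↔
      T.indicator (1 : α → ℤ) a + T.indicator 1 b + T.indicator 1 c = 1 := by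
  by_cases ha : a ∈ T <;> by_cases hb : b ∈ T <;> by_cases hc : c ∈ T <;>
    simp only [ha, hb, hc, Set.indicator_of_mem, Set.indicator_of_notMem, not_false_eq_true,
      Pi.one_apply] <;>
    simp only [ExistsUnique] <;> grind

theorem isTiling_univ_iff {T : Set Lozenge} :
    IsTiling Set.univ T ↔ ∀ v,
      increment T 0 v + increment T 1 (v + dir 0) + increment T 2 (v + dir 0 + dir 1) = 0 ∧
      increment T 1 v + increment T 0 (v + dir 1) + increment T 2 (v + dir 1 + dir 0) = 0 := by
  have hup (v : ℤ × ℤ) : (∃! l, l ∈ T ∧ Triangle.up v ∈ l.cells) ↔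
      increment T 0 v + increment T 1 (v + dir 0) + increment T 2 (v + dir 0 + dir 1) = 0 := by
    simp only [Lozenge.up_mem_cells, increment, rise, dir_cycle]
    rw [existsUnique_mem_three_iff (by simp) (by simp) (by simp)]
    norm_num
    omega
  have hdown (v : ℤ × ℤ) : (∃! l, l ∈ T ∧ Triangle.down v ∈ l.cells) ↔
      increment T 1 v + increment T 0 (v + dir 1) + increment T 2 (v + dir 1 + dir 0) = 0 := by
    simp only [Lozenge.down_mem_cells, increment, rise, dir_cycle']
    rw [existsUnique_mem_three_iff (by simp) (by simp) (by simp)]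
    norm_num
    omega
  simp only [isTiling_iff, Set.subset_univ, implies_true, true_and, Set.mem_univ, true_implies,
    ← hup, ← hdown]
  exact ⟨fun h v => ⟨h _, h _⟩, by rintro h (v | v); exacts [(h v).1, (h v).2]⟩

theorem mem_heightTiling_iff {z : ℤ × ℤ → ℤ} {k : Fin 3} {v : ℤ × ℤ} :
    (⟨k, v + dir k⟩ : Lozenge) ∈ heightTiling z ↔ z (v + dir k) < z v + rise k := by
  simp only [heightTiling, Set.mem_ofPred_eq, add_sub_cancel_right]

theorem IsHeightFunction.le_add_dir {z : ℤ × ℤ → ℤ} (hz : IsHeightFunction z) (v : ℤ × ℤ)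
    (k : Fin 3) : z v + rise k ≤ z (v + dir k) + 1 := by
  obtain ⟨i, hdir, hrise⟩ := exists_dir_add_dir_add_dir_eq_zero (show k ≠ k + 1 by simp)
  have hcycle : v + dir k + dir (k + 1) + dir i = v := by
    rw [add_assoc, add_assoc, ← add_assoc (dir k), hdir, add_zero]
  have h₁ := hz (v + dir k) (k + 1)
  have h₂ := hz (v + dir k + dir (k + 1)) i
  rw [hcycle] at h₂
  omega

theorem IsHeightFunction.increment_heightTiling {z : ℤ × ℤ → ℤ} (hz : IsHeightFunction z)
    (k : Fin 3) (v : ℤ × ℤ) : increment (heightTiling z) k v = z (v + dir k) - z v := by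
  have hle := hz v k
  have hge := hz.le_add_dir v k
  by_cases h : (⟨k, v + dir k⟩ : Lozenge) ∈ heightTiling z <;>
    simp only [increment, h, Set.indicator_of_mem, Set.indicator_of_notMem, not_false_eq_true,
      Pi.one_apply] <;>
    rw [mem_heightTiling_iff] at h <;> omega

theorem IsHeightFunction.isTiling {z : ℤ × ℤ → ℤ} (hz : IsHeightFunction z) :
    IsTiling Set.univ (heightTiling z) := by
  refine isTiling_univ_iff.2 fun v => ?_
  simp only [hz.increment_heightTiling, dir_cycle, dir_cycle']
  constructor <;> ring

theorem exists_forall_add_one_eq {G : Type*} [AddCommGroup G] (f : ℤ → G) :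
    ∃ F : ℤ → G, ∀ n, F (n + 1) = F n + f n := by
  refine ⟨fun n => ∑ i ∈ Finset.Ico 0 n, f i - ∑ i ∈ Finset.Ico n 0, f i, fun n => ?_⟩
  rcases le_or_gt 0 n with h | h
  · simp only [Finset.Ico_eq_empty_of_le (show (0 : ℤ) ≤ n + 1 by omega),
      Finset.Ico_eq_empty_of_le h, Finset.sum_empty, sub_zero]
    rw [← Finset.insert_Ico_right_eq_Ico_add_one h, Finset.sum_insert (by simp), add_comm]
  · simp only [Finset.Ico_eq_empty_of_le (show n + 1 ≤ (0 : ℤ) by omega),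
      Finset.Ico_eq_empty_of_le h.le, Finset.sum_empty, zero_sub]
    rw [← Finset.insert_Ico_add_one_left_eq_Ico h, Finset.sum_insert (by simp)]
    abel

theorem exists_potential_square {G : Type*} [AddCommGroup G] (f g : ℤ → ℤ → G)
    (h : ∀ x y, f x y + g (x + 1) y = g x y + f x (y + 1)) :
    ∃ F : ℤ → ℤ → G, ∀ x y, F (x + 1) y = F x y + f x y ∧ F x (y + 1) = F x y + g x y := by
  obtain ⟨F₀, hF₀⟩ := exists_forall_add_one_eq fun x => f x 0
  choose H hH using fun x => exists_forall_add_one_eq (g x)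
  refine ⟨fun x y => F₀ x + (H x y - H x 0), fun x y => ⟨?_, by simp only [hH]; abel⟩⟩
  have hstep (y : ℤ) : H (x + 1) (y + 1) - H x (y + 1) - f x (y + 1) =
      H (x + 1) y - H x y - f x y := by
    rw [hH, hH, ← sub_eq_zero, ← sub_eq_zero.2 (h x y)]
    abel
  have hconst : H (x + 1) y - H x y - f x y = H (x + 1) 0 - H x 0 - f x 0 := by
    induction y using Int.induction_on with
    | zero => rfl
    | succ i ih => rw [hstep, ih]
    | pred i ih => rw [← ih, ← hstep, sub_add_cancel]
  simp only [hF₀]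
  rw [← sub_eq_zero, ← sub_eq_zero.2 hconst]
  abel

theorem exists_potential {G : Type*} [AddCommGroup G] (a : Fin 3 → ℤ × ℤ → G)
    (hup : ∀ v, a 0 v + a 1 (v + dir 0) + a 2 (v + dir 0 + dir 1) = 0)
    (hdown : ∀ v, a 1 v + a 0 (v + dir 1) + a 2 (v + dir 1 + dir 0) = 0) :
    ∃ z : ℤ × ℤ → G, ∀ v k, z (v + dir k) = z v + a k v := by
  have hsquare (v : ℤ × ℤ) : a 0 v + a 1 (v + dir 0) = a 1 v + a 0 (v + dir 1) := by
    rw [eq_neg_of_add_eq_zero_left (hup v), eq_neg_of_add_eq_zero_left (hdown v),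
      add_right_comm]
  obtain ⟨F, hF⟩ := exists_potential_square (fun x y => a 0 (x, y)) (fun x y => a 1 (x, y))
    fun x y => by simpa [dir] using hsquare (x, y)
  set z : ℤ × ℤ → G := fun v => F v.1 v.2
  have h₀ (v : ℤ × ℤ) : z (v + dir 0) = z v + a 0 v := by simpa [z, dir] using (hF v.1 v.2).1
  have h₁ (v : ℤ × ℤ) : z (v + dir 1) = z v + a 1 v := by simpa [z, dir] using (hF v.1 v.2).2
  have h₂ (v : ℤ × ℤ) : z (v + dir 2) = z v + a 2 v := by
    obtain ⟨w, rfl⟩ : ∃ w, v = w + dir 0 + dir 1 := ⟨v + dir 2, by ext <;> simp [dir]⟩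
    rw [dir_cycle, h₁, h₀, add_assoc (z w), add_assoc (z w), hup, add_zero]
  exact ⟨z, fun v k => by fin_cases k; exacts [h₀ v, h₁ v, h₂ v]⟩

theorem exists_heightTiling_eq {T : Set Lozenge} (hT : IsTiling Set.univ T) :
    ∃ z, IsHeightFunction z ∧ heightTiling z = T := by
  obtain ⟨z, hz⟩ := exists_potential (increment T) (fun v => (isTiling_univ_iff.1 hT v).1)
    fun v => (isTiling_univ_iff.1 hT v).2
  refine ⟨z, fun v k => ?_, Set.ext fun ⟨k, w⟩ => ?_⟩
  · rw [hz, increment, add_le_add_iff_left]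
    exact sub_le_self _ (Set.indicator_nonneg (fun _ _ => zero_le_one) _)
  · obtain ⟨v, rfl⟩ : ∃ v, w = v + dir k := ⟨w - dir k, (sub_add_cancel w _).symm⟩
    rw [mem_heightTiling_iff, hz, add_lt_add_iff_left, increment]
    by_cases h : (⟨k, v + dir k⟩ : Lozenge) ∈ T <;> simp [h]

theorem IsHeightFunction.exists_sub_eq_of_heightTiling_eq {z z' : ℤ × ℤ → ℤ}
    (hz : IsHeightFunction z) (hz' : IsHeightFunction z')
    (h : heightTiling z = heightTiling z') : ∃ c, ∀ v, z v - z' v = c := by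
  have hperiodic (k : Fin 3) : Function.Periodic (z - z') (dir k) := fun v => by
    have hinc := hz.increment_heightTiling k v
    rw [h, hz'.increment_heightTiling] at hinc
    simp only [Pi.sub_apply]
    omega
  refine ⟨(z - z') 0, fun v => ?_⟩
  have hv : v = v.1 • dir 0 + v.2 • dir 1 := by ext <;> simp [dir]
  rw [← Pi.sub_apply, hv, (hperiodic 1).zsmul, (hperiodic 0).zsmul_eq]

theorem IsHeightFunction.eq_add_rise_of_mem_heightTiling {z : ℤ × ℤ → ℤ}
    (hz : IsHeightFunction z) {j k : Fin 3} {v : ℤ × ℤ}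
    (hj : (⟨j, v⟩ : Lozenge) ∈ heightTiling z) (hkj : k ≠ j) :
    z (v + dir k) = z v + rise k := by
  obtain ⟨i, hdir, hrise⟩ := exists_dir_add_dir_add_dir_eq_zero hkj
  have hcycle : v + dir k + dir i = v - dir j := by
    rw [eq_sub_iff_add_eq, add_assoc, add_assoc, add_comm (dir i), ← add_assoc (dir k), hdir,
      add_zero]
  have hlt : z v < z (v - dir j) + rise j := hj
  have h₁ := hz v k
  have h₂ := hz (v + dir k) i
  rw [hcycle] at h₂
  omega

/-! ### Compact piles and their heights -/

theorem covBy_iff_exists_eq_add_single {ι : Type*} [DecidableEq ι] {p q : ι → ℕ} :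
    p ⋖ q ↔ ∃ k, q = p + Pi.single k 1 := by
  simp only [Pi.covBy_iff, Nat.covBy_iff_add_one_eq, funext_iff, Pi.add_apply]
  refine exists_congr fun k =>
    ⟨fun ⟨hk, h⟩ i => ?_, fun h => ⟨by simp [h], fun i hi => by simp [h, hi]⟩⟩
  rcases eq_or_ne i k with rfl | hi
  · simp [hk]
  · simp [h i hi, hi]

theorem isLowerSet_iff_forall_add_single {P : Set Cube} :
    IsLowerSet P ↔ ∀ p k, p + Pi.single k 1 ∈ P → p ∈ P := by
  change IsLowerSet {p | p ∈ P} ↔ _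
  rw [isLowerSet_setOfPred, antitone_iff_forall_covBy]
  simp only [covBy_iff_exists_eq_add_single]
  exact ⟨fun h p k => h _ _ ⟨k, rfl⟩, by rintro h p _ ⟨k, rfl⟩; exact h p k⟩

theorem isCompactPile_iff_isLowerSet {P : Set Cube} : IsCompactPile P ↔ IsLowerSet P := by
  refine ⟨fun h => isLowerSet_iff_forall_add_single.2 fun p k hp => ?_, fun h p hp k i hi =>
    h (update_le_iff.2 ⟨hi, fun _ _ => le_rfl⟩) hp⟩
  convert h _ hp k (p k) (by simp)
  ext i
  rcases eq_or_ne i k with rfl | hi <;> simp [*]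

theorem proj_add_single (p : Cube) (k : Fin 3) : proj (p + Pi.single k 1) = proj p + dir k := by
  fin_cases k <;> ext <;> simp [proj, dir] <;> ring

theorem add_single_two (p : Cube) (k : Fin 3) :
    (((p + Pi.single k 1 : Cube) 2 : ℕ) : ℤ) = p 2 + rise k := by
  fin_cases k <;> simp [rise]

theorem single_one_le {p : Cube} {k : Fin 3} (hk : p k ≠ 0) : Pi.single k 1 ≤ p := by
  intro i
  rcases eq_or_ne i k with rfl | hi
  · simpa using Nat.one_le_iff_ne_zero.2 hk
  · simp [hi]

theorem exists_eq_add_single {p : Cube} {k : Fin 3} (hk : p k ≠ 0) :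
    ∃ q : Cube, p = q + Pi.single k 1 :=
  ⟨p - Pi.single k 1, (tsub_add_cancel_of_le (single_one_le hk)).symm⟩

theorem apply_sub_apply_eq_of_proj_eq {p q : Cube} (h : proj p = proj q) (i : Fin 3) :
    (p i : ℤ) - q i = p 2 - q 2 := by
  simp only [proj, Prod.mk.injEq] at h
  fin_cases i <;> simp only [Fin.zero_eta, Fin.mk_one, Fin.reduceFinMk] <;> omega

theorem le_of_proj_eq {p q : Cube} (h : proj p = proj q) {i : Fin 3} (hi : p i ≤ q i) : p ≤ q := by
  intro j
  change p j ≤ q j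
  have h₁ := apply_sub_apply_eq_of_proj_eq h i
  have h₂ := apply_sub_apply_eq_of_proj_eq h j
  omega

theorem eq_of_proj_eq {p q : Cube} (h : proj p = proj q) {i : Fin 3} (hi : p i = q i) : p = q :=
  (le_of_proj_eq h hi.le).antisymm (le_of_proj_eq h.symm hi.ge)

theorem exists_eq_add_one {p : Cube} (hp : ∀ k, p k ≠ 0) : ∃ q, p = q + 1 :=
  ⟨p - 1, (tsub_add_cancel_of_le fun k => Nat.one_le_iff_ne_zero.2 (hp k)).symm⟩

theorem proj_add_one (p : Cube) : proj (p + 1) = proj p := by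
  ext <;> simp [proj]

/-- How far above the point `q` the stepped surface with the height function `z` passes: negative if
it passes below `q`. -/
def excess (z : ℤ × ℤ → ℤ) (q : Cube) : ℤ := z (proj q) - q 2

theorem IsHeightFunction.antitone_excess {z : ℤ × ℤ → ℤ} (hz : IsHeightFunction z) :
    Antitone (excess z) := by
  refine (antitone_iff_forall_covBy _).2 fun p q hpq => ?_
  obtain ⟨k, rfl⟩ := covBy_iff_exists_eq_add_single.1 hpq
  have hk := hz (proj p) k
  rw [excess, excess, proj_add_single, add_single_two]
  omega

/-- The third coordinates of the points of the octant over `v` that are not in `P`. -/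
def freeHeights (P : Set Cube) (v : ℤ × ℤ) : Set ℤ := {t | ∃ q ∉ P, proj q = v ∧ (q 2 : ℤ) = t}

/-- The height over `v` of the surface of the pile `P`, put on the walls of the octant: the third
coordinate of the lowest point over `v` that is not in `P`. -/
noncomputable def pileHeight (P : Set Cube) (v : ℤ × ℤ) : ℤ := sInf (freeHeights P v)

theorem exists_proj_eq {v : ℤ × ℤ} {t : ℤ} (h₀ : 0 ≤ v.1 + t) (h₁ : 0 ≤ v.2 + t) (h₂ : 0 ≤ t) :
    ∃ q : Cube, proj q = v ∧ (q 2 : ℤ) = t :=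
  ⟨![(v.1 + t).toNat, (v.2 + t).toNat, t.toNat], by ext <;> simp [proj, *], by simp [h₂]⟩

theorem exists_notMem_proj_eq {P : Set Cube} (hP : P.Finite) (v : ℤ × ℤ) :
    ∃ q ∉ P, proj q = v := by
  obtain ⟨N, hN⟩ := hP.bddAbove
  obtain ⟨q, hqv, hq⟩ := exists_proj_eq (v := v) (t := N 2 + 1 + v.1.natAbs + v.2.natAbs)
    (by omega) (by omega) (by omega)
  refine ⟨q, fun hqP => ?_, hqv⟩
  have hqN : q 2 ≤ N 2 := hN hqP 2
  omega

theorem bddBelow_freeHeights (P : Set Cube) (v : ℤ × ℤ) : BddBelow (freeHeights P v) :=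
  ⟨0, by rintro _ ⟨q, -, -, rfl⟩; exact Int.natCast_nonneg _⟩

theorem pileHeight_le {P : Set Cube} {q : Cube} (hq : q ∉ P) : pileHeight P (proj q) ≤ q 2 :=
  csInf_le (bddBelow_freeHeights P _) ⟨q, hq, rfl, rfl⟩

theorem exists_notMem_eq_pileHeight {P : Set Cube} (hP : P.Finite) (v : ℤ × ℤ) :
    ∃ q ∉ P, proj q = v ∧ (q 2 : ℤ) = pileHeight P v := by
  obtain ⟨q, hq, hqv⟩ := exists_notMem_proj_eq hP v
  have hne : (freeHeights P v).Nonempty := ⟨q 2, q, hq, hqv, rfl⟩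
  exact Int.csInf_mem hne (bddBelow_freeHeights P v)

theorem mem_iff_lt_pileHeight {P : Set Cube} (hP : P.Finite) (hlow : IsLowerSet P) {q : Cube} :
    q ∈ P ↔ (q 2 : ℤ) < pileHeight P (proj q) := by
  refine ⟨fun hq => ?_, fun h => not_imp_comm.1 pileHeight_le h.not_ge⟩
  obtain ⟨r, hr, hrq, hr₂⟩ := exists_notMem_eq_pileHeight hP (proj q)
  by_contra! hle
  exact hr (hlow (le_of_proj_eq (i := 2) hrq (by omega)) hq)

theorem isHeightFunction_pileHeight {P : Set Cube} (hP : P.Finite) (hlow : IsLowerSet P) :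
    IsHeightFunction (pileHeight P) := by
  intro v k
  obtain ⟨q, hq, rfl, hq₂⟩ := exists_notMem_eq_pileHeight hP v
  rw [← proj_add_single, ← hq₂, ← add_single_two]
  exact pileHeight_le fun h => hq (isLowerSet_iff_forall_add_single.1 hlow q k h)

theorem eq_of_pileHeight_eq {P P' : Set Cube} (hP : P.Finite) (hlow : IsLowerSet P)
    (hP' : P'.Finite) (hlow' : IsLowerSet P') (h : pileHeight P = pileHeight P') : P = P' := by
  ext q
  rw [mem_iff_lt_pileHeight hP hlow, mem_iff_lt_pileHeight hP' hlow', h]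

/-- The cubes that lie below the stepped surface with the height function `z`. -/
def pileBelow (z : ℤ × ℤ → ℤ) : Set Cube := {q | 0 < excess z q}

theorem IsHeightFunction.isLowerSet_pileBelow {z : ℤ × ℤ → ℤ} (hz : IsHeightFunction z) :
    IsLowerSet (pileBelow z) :=
  fun _ _ hle h => lt_of_lt_of_le h (hz.antitone_excess hle)

theorem pileHeight_pileBelow {z : ℤ × ℤ → ℤ} (hfin : (pileBelow z).Finite)
    (hwall : ∀ q k, q k = 0 → 0 ≤ excess z q) : pileHeight (pileBelow z) = z := by
  ext v
  obtain ⟨q, hq, rfl, hq₂⟩ := exists_notMem_eq_pileHeight hfin v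
  rw [← hq₂]
  refine le_antisymm ?_ (by simpa [pileBelow, excess] using hq)
  by_cases hk : ∃ k, q k = 0
  · obtain ⟨k, hk⟩ := hk
    exact sub_nonneg.1 (hwall q k hk)
  · obtain ⟨r, rfl⟩ := exists_eq_add_one (not_exists.1 hk)
    have hr : r ∈ pileBelow z := by
      by_contra hr
      have := pileHeight_le hr
      simp only [proj_add_one, Pi.add_apply, Pi.one_apply, Nat.cast_add, Nat.cast_one] at hq₂
      omega
    simpa [pileBelow, excess, proj_add_one, Int.add_one_le_iff] using hr

/-! ### The surface of a pile -/

theorem mem_surface_univ_iff {P : Set Cube} {s : Square} :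
    s ∈ surface Set.univ P ↔ s.corner ∉ P ∧
      (s.corner s.axis = 0 ∨ ∃ p ∈ P, s.corner = p + Pi.single s.axis 1) := by
  simp only [surface, visibleFaces, baseSquares, Set.mem_union, Set.mem_ofPred_eq,
    Set.subset_univ, and_true]
  grind

theorem pileHeight_proj_corner {P : Set Cube} (hP : P.Finite) (hlow : IsLowerSet P) {s : Square}
    (hs : s ∈ surface Set.univ P) : pileHeight P (proj s.corner) = s.corner 2 := by
  obtain ⟨hfree, hbase⟩ := mem_surface_univ_iff.1 hs
  refine (pileHeight_le hfree).antisymm ?_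
  obtain ⟨q, hq, hqs, hq₂⟩ := exists_notMem_eq_pileHeight hP (proj s.corner)
  rw [← hq₂]
  by_contra! hlt
  have hsucc : q + 1 ≤ s.corner :=
    le_of_proj_eq (i := 2) (by rw [proj_add_one, hqs]) (by simp; omega)
  obtain hbase | ⟨p, hp, hps⟩ := hbase
  · simpa [hbase] using hsucc s.axis
  · refine hq (hlow (?_ : q ≤ p) hp)
    rw [← add_le_add_iff_right (Pi.single s.axis 1), ← hps]
    refine le_trans ?_ hsucc
    gcongr
    exact single_one_le one_ne_zero

theorem mapsTo_toLozenge_surface_univ {P : Set Cube} (hP : P.Finite) (hlow : IsLowerSet P) :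
    Set.MapsTo Square.toLozenge (surface Set.univ P) (heightTiling (pileHeight P)) := by
  rintro ⟨k, c⟩ hs
  have hc := pileHeight_proj_corner hP hlow hs
  obtain ⟨q, hq, hqc, hq₂⟩ := exists_notMem_eq_pileHeight hP (proj c - dir k)
  have hproj : proj (q + Pi.single k 1) = proj c := by
    rw [proj_add_single, hqc, sub_add_cancel]
  change pileHeight P (proj c) < pileHeight P (proj c - dir k) + rise k
  rw [hc, ← hq₂, ← add_single_two]
  by_contra! hle
  have hle : q + Pi.single k 1 ≤ c := le_of_proj_eq (i := 2) hproj (by exact_mod_cast hle)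
  obtain hbase | ⟨p, hp, hpc⟩ := (mem_surface_univ_iff.1 hs).2
  · simpa [show c k = 0 from hbase] using hle k
  · rw [show c = p + Pi.single k 1 from hpc] at hle
    exact hq (hlow (le_of_add_le_add_right hle) hp)

theorem bijOn_toLozenge_surface_univ {P : Set Cube} (hP : P.Finite) (hlow : IsLowerSet P) :
    Set.BijOn Square.toLozenge (surface Set.univ P) (heightTiling (pileHeight P)) := by
  refine ⟨mapsTo_toLozenge_surface_univ hP hlow, ?_, ?_⟩
  · intro s hs s' hs' h
    obtain ⟨haxis, hproj⟩ := Lozenge.mk.inj h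
    refine Square.ext haxis (eq_of_proj_eq (i := 2) hproj ?_)
    have hc := pileHeight_proj_corner hP hlow hs
    rw [hproj, pileHeight_proj_corner hP hlow hs'] at hc
    exact_mod_cast hc.symm
  · rintro ⟨k, w⟩ hl
    obtain ⟨q, hq, rfl, hq₂⟩ := exists_notMem_eq_pileHeight hP w
    refine ⟨⟨k, q⟩, mem_surface_univ_iff.2 ⟨hq, or_iff_not_imp_left.2 fun hk => ?_⟩, rfl⟩
    obtain ⟨r, rfl⟩ := exists_eq_add_single (k := k) hk
    refine ⟨r, (mem_iff_lt_pileHeight hP hlow).2 ?_, rfl⟩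
    have hl : pileHeight P (proj (r + Pi.single k 1)) <
        pileHeight P (proj (r + Pi.single k 1) - dir k) + rise k := hl
    rw [← hq₂, add_single_two, proj_add_single, add_sub_cancel_right] at hl
    exact lt_of_add_lt_add_right hl

/-! ### Tilings of parts of a domain -/

theorem Lozenge.cells_nonempty (l : Lozenge) : l.cells.Nonempty := by
  obtain ⟨k, v⟩ := l
  fin_cases k <;> exact ⟨_, Or.inl rfl⟩

theorem Lozenge.cells_subset_region {T : Set Lozenge} {l : Lozenge} (hl : l ∈ T) :
    l.cells ⊆ region T :=
  Set.subset_biUnion_of_mem (u := Lozenge.cells) hl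

theorem region_union (T T' : Set Lozenge) : region (T ∪ T') = region T ∪ region T' :=
  Set.biUnion_union T T' Lozenge.cells

theorem IsTiling.union {D D' : Set Triangle} {T T' : Set Lozenge} (h : IsTiling D T)
    (h' : IsTiling D' T') (hD : Disjoint D D') : IsTiling (D ∪ D') (T ∪ T') := by
  obtain ⟨hT, rfl⟩ := h
  obtain ⟨hT', rfl⟩ := h'
  exact ⟨Set.pairwiseDisjoint_union.2 ⟨hT, hT', fun l hl l' hl' _ =>
    hD.mono (Lozenge.cells_subset_region hl) (Lozenge.cells_subset_region hl')⟩, region_union T T'⟩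

theorem IsTiling.disjoint {D D' : Set Triangle} {T T' : Set Lozenge} (h : IsTiling D T)
    (h' : IsTiling D' T') (hD : Disjoint D D') : Disjoint T T' := by
  obtain ⟨-, rfl⟩ := h
  obtain ⟨-, rfl⟩ := h'
  refine Set.disjoint_left.2 fun l hl hl' => ?_
  obtain ⟨t, ht⟩ := l.cells_nonempty
  exact Set.disjoint_left.1 hD (Lozenge.cells_subset_region hl ht)
    (Lozenge.cells_subset_region hl' ht)

theorem IsTiling.sdiff {D : Set Triangle} {T O : Set Lozenge} (h : IsTiling D T) (hO : O ⊆ T) :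
    IsTiling (D \ region O) (T \ O) := by
  obtain ⟨hT, rfl⟩ := h
  refine ⟨hT.subset Set.sdiff_subset, ?_⟩
  have hdisj : Disjoint (region (T \ O)) (region O) := by
    simp only [region, Set.disjoint_iUnion_left, Set.disjoint_iUnion_right]
    exact fun l hl l' hl' => hT hl'.1 (hO hl) (ne_of_mem_of_not_mem hl hl'.2).symm
  have hunion : region T = region (T \ O) ∪ region O := by
    rw [← region_union, Set.sdiff_union_of_subset hO]
  rw [hunion, Set.union_sdiff_right, hdisj.sdiff_eq_left]

/-! ### The domain of a compact pile -/

/-- The domain covered by a pile seen from the direction `(1,1,1)`. Flips do not change it, so it is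
the pseudo-hexagon that the pile defines. -/
def domain (Q : Set Cube) : Set Triangle := region (Square.toLozenge '' visibleFaces Q)

/-- The squares of the walls of the octant on which no cube of `Q` stands. -/
def outerSquares (Q : Set Cube) : Set Square := {s | s.corner s.axis = 0 ∧ s.corner ∉ Q}

/-- The pile of all the cubes whose projections to the three walls of the octant belong to `Q`: the
greatest compact pile in `domain Q`. -/
def maxPile (Q : Set Cube) : Set Cube := {p | ∀ k, Function.update p k 0 ∈ Q}

theorem surface_univ (P : Set Cube) :
    surface Set.univ P = visibleFaces P ∪ outerSquares P := by
  simp [surface, baseSquares, outerSquares]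

theorem outerSquares_subset_surface_univ (P : Set Cube) :
    outerSquares P ⊆ surface Set.univ P :=
  surface_univ P ▸ Set.subset_union_right

theorem disjoint_visibleFaces_outerSquares (P Q : Set Cube) :
    Disjoint (visibleFaces P) (outerSquares Q) := by
  refine Set.disjoint_left.2 ?_
  rintro s ⟨p, -, hs, -⟩ ⟨hs₀, -⟩
  simp [hs] at hs₀

section Piles

variable {P P' Q : Set Cube}

theorem isTiling_surface_univ (hP : P.Finite) (hlow : IsLowerSet P) :
    IsTiling Set.univ (Square.toLozenge '' surface Set.univ P) := by
  rw [(bijOn_toLozenge_surface_univ hP hlow).image_eq]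
  exact (isHeightFunction_pileHeight hP hlow).isTiling

theorem domain_eq_compl (hQ : Q.Finite) (hlow : IsLowerSet Q) :
    domain Q = (region (Square.toLozenge '' outerSquares Q))ᶜ := by
  have hsub := outerSquares_subset_surface_univ Q
  have htiling := (isTiling_surface_univ hQ hlow).sdiff (Set.image_mono hsub)
  rw [← (bijOn_toLozenge_surface_univ hQ hlow).injOn.image_sdiff_subset hsub, surface_univ,
    Set.union_sdiff_right, (disjoint_visibleFaces_outerSquares Q Q).sdiff_eq_left,
    ← Set.compl_eq_univ_sdiff] at htiling
  exact htiling.2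

theorem isTiling_outerSquares (hQ : Q.Finite) (hlow : IsLowerSet Q) :
    IsTiling (domain Q)ᶜ (Square.toLozenge '' outerSquares Q) := by
  rw [domain_eq_compl hQ hlow, compl_compl]
  exact ⟨(isTiling_surface_univ hQ hlow).1.subset
    (Set.image_mono (outerSquares_subset_surface_univ Q)), rfl⟩

theorem eq_of_mem_cells_of_wall {s s' : Square} (hs : s.corner s.axis = 0)
    (hs' : s'.corner s'.axis = 0) {t : Triangle} (ht : t ∈ s.toLozenge.cells)
    (ht' : t ∈ s'.toLozenge.cells) : s = s' := by
  have hmem : ∀ {s : Square}, s.corner s.axis = 0 → s ∈ surface Set.univ ∅ := fun h =>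
    outerSquares_subset_surface_univ ∅ ⟨h, Set.notMem_empty _⟩
  have hloz := (isTiling_surface_univ Set.finite_empty isLowerSet_empty).1.elim_set
    (Set.mem_image_of_mem _ (hmem hs)) (Set.mem_image_of_mem _ (hmem hs')) t ht ht'
  exact (bijOn_toLozenge_surface_univ Set.finite_empty isLowerSet_empty).injOn
    (hmem hs) (hmem hs') hloz

theorem mem_of_wall_of_mem_domain (hQ : Q.Finite) (hlow : IsLowerSet Q) {s : Square}
    (hs : s.corner s.axis = 0) {t : Triangle} (ht : t ∈ s.toLozenge.cells)
    (htD : t ∈ domain Q) : s.corner ∈ Q := by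
  by_contra hsQ
  have hsO : s ∈ outerSquares Q := ⟨hs, hsQ⟩
  rw [domain_eq_compl hQ hlow] at htD
  exact htD (Lozenge.cells_subset_region (Set.mem_image_of_mem _ hsO) ht)

theorem baseSquares_domain (hQ : Q.Finite) (hlow : IsLowerSet Q) :
    baseSquares (domain Q) = {s | s.corner s.axis = 0 ∧ s.corner ∈ Q} := by
  ext s
  refine and_congr_right fun hs => ⟨fun hsub => ?_, fun hsQ t ht => ?_⟩
  · obtain ⟨t, ht⟩ := s.toLozenge.cells_nonempty
    exact mem_of_wall_of_mem_domain hQ hlow hs ht (hsub ht)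
  · rw [domain_eq_compl hQ hlow]
    intro htO
    obtain ⟨_, ⟨o, ho, rfl⟩, hto⟩ := Set.mem_iUnion₂.1 htO
    exact ho.2 (eq_of_mem_cells_of_wall hs ho.1 ht hto ▸ hsQ)

theorem surface_domain (hQ : Q.Finite) (hlow : IsLowerSet Q) :
    surface (domain Q) P = surface Set.univ P \ outerSquares Q := by
  have hdisj := Set.disjoint_left.1 (disjoint_visibleFaces_outerSquares P Q)
  ext s
  have := @hdisj s
  rw [surface_univ, surface, baseSquares_domain hQ hlow]
  simp only [outerSquares, Set.mem_union, Set.mem_sdiff, Set.mem_ofPred_eq] at this ⊢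
  tauto

/-! ### Piles in the domain -/

theorem subset_maxPile (hlow : IsLowerSet Q) : Q ⊆ maxPile Q :=
  fun _ hp _ => hlow (update_le_self_iff.2 (Nat.zero_le _)) hp

theorem isLowerSet_maxPile (hlow : IsLowerSet Q) : IsLowerSet (maxPile Q) :=
  fun _ _ hle hp k => hlow (update_le_update_iff.2 ⟨le_rfl, fun j _ => hle j⟩) (hp k)

theorem finite_maxPile (hQ : Q.Finite) : (maxPile Q).Finite := by
  obtain ⟨N, hN⟩ := hQ.bddAbove
  refine (Set.finite_Iic N).subset fun p hp k => ?_
  simpa using hN (hp (k + 1)) k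

theorem mem_maxPile_iff_of_wall {p : Cube} {k : Fin 3} (hk : p k = 0) (hlow : IsLowerSet Q) :
    p ∈ maxPile Q ↔ p ∈ Q := by
  refine ⟨fun h => ?_, fun h => subset_maxPile hlow h⟩
  simpa [← hk] using h k

theorem outerSquares_maxPile (hlow : IsLowerSet Q) : outerSquares (maxPile Q) = outerSquares Q :=
  Set.ext fun _ => and_congr_right fun hs => not_congr (mem_maxPile_iff_of_wall hs hlow)

theorem outerSquares_subset_surface_univ_of_subset (hlow : IsLowerSet Q) (hPQ : P ⊆ maxPile Q) :
    outerSquares Q ⊆ surface Set.univ P := by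
  rw [← outerSquares_maxPile hlow]
  exact fun s hs => outerSquares_subset_surface_univ P ⟨hs.1, fun h => hs.2 (hPQ h)⟩

theorem image_outerSquares_subset_heightTiling (hQ : Q.Finite) (hlowQ : IsLowerSet Q)
    (hlow : IsLowerSet P) (hPQ : P ⊆ maxPile Q) :
    Square.toLozenge '' outerSquares Q ⊆ heightTiling (pileHeight P) := by
  rw [← (bijOn_toLozenge_surface_univ ((finite_maxPile hQ).subset hPQ) hlow).image_eq]
  exact Set.image_mono (outerSquares_subset_surface_univ_of_subset hlowQ hPQ)

theorem correspondsTo_domain (hQ : Q.Finite) (hlowQ : IsLowerSet Q) (hlow : IsLowerSet P)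
    (hPQ : P ⊆ maxPile Q) :
    CorrespondsTo (domain Q) P
      (heightTiling (pileHeight P) \ Square.toLozenge '' outerSquares Q) := by
  have hbij := bijOn_toLozenge_surface_univ ((finite_maxPile hQ).subset hPQ) hlow
  rw [CorrespondsTo, surface_domain hQ hlowQ, ← hbij.image_eq,
    ← hbij.injOn.image_sdiff_subset (outerSquares_subset_surface_univ_of_subset hlowQ hPQ)]
  exact (hbij.injOn.mono Set.sdiff_subset).bijOn_image

theorem image_surface_domain (hQ : Q.Finite) (hlowQ : IsLowerSet Q) (hlow : IsLowerSet P)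
    (hPQ : P ⊆ maxPile Q) : Square.toLozenge '' surface (domain Q) P =
      heightTiling (pileHeight P) \ Square.toLozenge '' outerSquares Q :=
  (correspondsTo_domain hQ hlowQ hlow hPQ).image_eq

theorem isTiling_domain (hQ : Q.Finite) (hlowQ : IsLowerSet Q) (hlow : IsLowerSet P)
    (hPQ : P ⊆ maxPile Q) :
    IsTiling (domain Q) (Square.toLozenge '' surface (domain Q) P) := by
  rw [image_surface_domain hQ hlowQ hlow hPQ, domain_eq_compl hQ hlowQ, Set.compl_eq_univ_sdiff]
  exact (isHeightFunction_pileHeight ((finite_maxPile hQ).subset hPQ) hlow).isTiling.sdiff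
    (image_outerSquares_subset_heightTiling hQ hlowQ hlow hPQ)

theorem region_hexagon (v : ℤ × ℤ) : region (Set.range fun k => (⟨k, v + dir k⟩ : Lozenge)) =
    region (Set.range fun k => (⟨k, v⟩ : Lozenge)) := by
  obtain ⟨x, y⟩ := v
  ext (⟨s, t⟩ | ⟨s, t⟩) <;>
    simp [region, Fin.exists_fin_succ, Lozenge.cells, dir] <;> omega

theorem hexagon_eq_region_upper_faces (p : Cube) : hexagon p =
    region (Set.range fun k => (⟨k, p + Pi.single k 1⟩ : Square).toLozenge) := by
  simp only [hexagon, Square.toLozenge, proj_add_single, region_hexagon]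

theorem hexagon_subset_domain (hQ : Q.Finite) (hlow : IsLowerSet Q) {p : Cube}
    (hp : p ∈ maxPile Q) : hexagon p ⊆ domain Q := by
  have hsub : Set.Iic p ⊆ maxPile Q := fun q hq => isLowerSet_maxPile hlow hq hp
  rw [hexagon_eq_region_upper_faces, ← (isTiling_domain hQ hlow (isLowerSet_Iic p) hsub).2]
  refine Set.biUnion_subset_biUnion_left ?_
  rintro _ ⟨k, rfl⟩
  refine Set.mem_image_of_mem _ (Or.inl ⟨p, Set.self_mem_Iic, rfl, fun hle => ?_⟩)
  simpa using hle k

theorem isPileIn_domain_iff (hQ : Q.Finite) (hlowQ : IsLowerSet Q) (hlow : IsLowerSet P) :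
    IsPileIn (domain Q) P ↔ P ⊆ maxPile Q := by
  refine ⟨fun h p hp k => ?_, fun h =>
    ⟨(finite_maxPile hQ).subset h, fun p hp => hexagon_subset_domain hQ hlowQ (h hp)⟩⟩
  have hwall : (⟨k, Function.update p k 0⟩ : Square) ∈ baseSquares (domain Q) :=
    ⟨by simp, (Lozenge.cells_subset_region (Set.mem_range_self k)).trans
      (h.2 _ (hlow (update_le_self_iff.2 (Nat.zero_le _)) hp))⟩
  rw [baseSquares_domain hQ hlowQ] at hwall
  exact hwall.2

theorem setOf_isPileIn_domain_and_isCompactPile (hQ : Q.Finite) (hlow : IsLowerSet Q) :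
    {P | IsPileIn (domain Q) P ∧ IsCompactPile P} = {P | IsLowerSet P ∧ P ⊆ maxPile Q} := by
  ext P
  rw [Set.mem_ofPred_eq, and_comm, isCompactPile_iff_isLowerSet]
  exact and_congr_right (isPileIn_domain_iff hQ hlow)

/-! ### The bijection between compact piles and tilings -/

theorem correspondsTo_image_surface_domain (hQ : Q.Finite) (hlow : IsLowerSet Q)
    (hP : IsPileIn (domain Q) P) (hcompact : IsCompactPile P) :
    CorrespondsTo (domain Q) P (Square.toLozenge '' surface (domain Q) P) := by
  rw [isCompactPile_iff_isLowerSet] at hcompact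
  have hPQ := (isPileIn_domain_iff hQ hlow hcompact).1 hP
  exact (correspondsTo_domain hQ hlow hcompact hPQ).injOn.bijOn_image

theorem exists_forall_single_notMem (hP : P.Finite) : ∃ N, ∀ k, Pi.single k N ∉ P := by
  obtain ⟨M, hM⟩ := hP.bddAbove
  refine ⟨Finset.univ.sup M + 1, fun k hk => ?_⟩
  have hle : Finset.univ.sup M + 1 ≤ M k := by simpa using hM hk k
  exact (Finset.le_sup (f := M) (Finset.mem_univ k)).not_gt hle

theorem pileHeight_proj_of_wall (hP : P.Finite) (hlow : IsLowerSet P) {q : Cube} (hq : q ∉ P)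
    {k : Fin 3} (hk : q k = 0) : pileHeight P (proj q) = q 2 :=
  pileHeight_proj_corner (s := ⟨k, q⟩) hP hlow
    (outerSquares_subset_surface_univ P ⟨hk, hq⟩)

theorem eq_of_image_surface_domain_eq (hQ : Q.Finite) (hlowQ : IsLowerSet Q)
    (hlow : IsLowerSet P) (hPQ : P ⊆ maxPile Q) (hlow' : IsLowerSet P') (hPQ' : P' ⊆ maxPile Q)
    (h : Square.toLozenge '' surface (domain Q) P =
      Square.toLozenge '' surface (domain Q) P') : P = P' := by
  have hfin := (finite_maxPile hQ).subset hPQ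
  have hfin' := (finite_maxPile hQ).subset hPQ'
  rw [image_surface_domain hQ hlowQ hlow hPQ, image_surface_domain hQ hlowQ hlow' hPQ'] at h
  have htiling : heightTiling (pileHeight P) = heightTiling (pileHeight P') := by
    rw [← Set.sdiff_union_of_subset (image_outerSquares_subset_heightTiling hQ hlowQ hlow hPQ), h,
      Set.sdiff_union_of_subset (image_outerSquares_subset_heightTiling hQ hlowQ hlow' hPQ')]
  obtain ⟨c, hc⟩ := (isHeightFunction_pileHeight hfin hlow).exists_sub_eq_of_heightTiling_eq
    (isHeightFunction_pileHeight hfin' hlow') htiling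
  obtain ⟨N, hN⟩ := exists_forall_single_notMem (finite_maxPile hQ)
  have hc₀ := hc (proj (Pi.single 0 N))
  rw [pileHeight_proj_of_wall (k := 1) hfin hlow (fun h => hN 0 (hPQ h)) (by simp),
    pileHeight_proj_of_wall (k := 1) hfin' hlow' (fun h => hN 0 (hPQ' h)) (by simp), sub_self]
    at hc₀
  exact eq_of_pileHeight_eq hfin hlow hfin' hlow'
    (funext fun v => sub_eq_zero.1 ((hc v).trans hc₀.symm))

theorem excess_eq_of_le_of_wall (hlow : IsLowerSet Q) {z : ℤ × ℤ → ℤ} (hz : IsHeightFunction z)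
    (hO : Square.toLozenge '' outerSquares Q ⊆ heightTiling z) {q r : Cube} {j : Fin 3}
    (hq : q ∉ Q) (hr : r j = 0) (hqr : q ≤ r) : excess z q = excess z r := by
  induction le_iff_reflTransGen_covBy.1 hqr with
  | refl => rfl
  | @tail b c hqb hbc ih =>
    have hqb := le_iff_reflTransGen_covBy.2 hqb
    obtain ⟨k, rfl⟩ := covBy_iff_exists_eq_add_single.1 hbc
    obtain ⟨hbj, hkj⟩ : b j = 0 ∧ j ≠ k := by
      rcases eq_or_ne j k with rfl | hjk
      · simp at hr
      · exact ⟨by simpa [hjk] using hr, hjk⟩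
    have hb : (⟨j, proj b⟩ : Lozenge) ∈ heightTiling z :=
      hO ⟨⟨j, b⟩, ⟨hbj, fun h => hq (hlow hqb h)⟩, rfl⟩
    rw [ih hbj hqb, excess, excess, proj_add_single, add_single_two,
      hz.eq_add_rise_of_mem_heightTiling hb hkj.symm]
    ring

theorem excess_eq_of_wall (hQ : Q.Finite) (hlow : IsLowerSet Q) {z : ℤ × ℤ → ℤ}
    (hz : IsHeightFunction z) (hO : Square.toLozenge '' outerSquares Q ⊆ heightTiling z)
    {q r : Cube} {i j : Fin 3} (hq : q ∉ Q) (hqi : q i = 0) (hr : r ∉ Q) (hrj : r j = 0) :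
    excess z q = excess z r := by
  obtain ⟨N, hN⟩ := exists_forall_single_notMem hQ
  obtain ⟨k, hik, hjk⟩ : ∃ k, i ≠ k ∧ j ≠ k := by clear * -; decide +revert
  -- The axis `k` lies in both walls, and the excess far out on it is that of any free wall point.
  have haxis {q : Cube} {i : Fin 3} (hq : q ∉ Q) (hqi : q i = 0) (hik : i ≠ k) :
      excess z q = excess z (Pi.single k N) := by
    have hsum : (q + Pi.single k N : Cube) i = 0 := by simp [hqi, hik]
    rw [excess_eq_of_le_of_wall hlow hz hO hq hsum le_self_add,
      excess_eq_of_le_of_wall hlow hz hO (hN k) hsum le_add_self]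
  rw [haxis hq hqi hik, haxis hr hrj hjk]

theorem exists_isHeightFunction_excess_eq_zero (hQ : Q.Finite) (hlow : IsLowerSet Q)
    {T : Set Lozenge} (hT : IsTiling Set.univ T) (hO : Square.toLozenge '' outerSquares Q ⊆ T) :
    ∃ z, IsHeightFunction z ∧ heightTiling z = T ∧
      ∀ q k, q k = 0 → q ∉ Q → excess z q = 0 := by
  obtain ⟨z, hz, rfl⟩ := exists_heightTiling_eq hT
  obtain ⟨N, hN⟩ := exists_forall_single_notMem hQ
  refine ⟨fun v => z v - excess z (Pi.single 0 N), fun v k => ?_, ?_, fun q k hk hq => ?_⟩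
  · linarith [hz v k]
  · ext l
    simp only [heightTiling, Set.mem_ofPred_eq]
    omega
  · have := excess_eq_of_wall hQ hlow hz hO (i := 1) (hN 0) (by simp) hq hk
    rw [this, excess, excess]
    ring

theorem excess_nonneg_of_wall (hQ : Q.Finite) (hlow : IsLowerSet Q) {z : ℤ × ℤ → ℤ}
    (hz : IsHeightFunction z) (hfree : ∀ q k, q k = 0 → q ∉ Q → excess z q = 0) {q : Cube}
    {k : Fin 3} (hk : q k = 0) : 0 ≤ excess z q := by
  obtain ⟨N, hN⟩ := exists_forall_single_notMem hQ
  rw [← hfree (q + Pi.single (k + 1) N) k (by simp [hk])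
    fun h => hN _ (hlow le_add_self h)]
  exact hz.antitone_excess le_self_add

theorem exists_image_surface_domain_eq (hQ : Q.Finite) (hlow : IsLowerSet Q)
    {T : Set Lozenge} (hT : IsTiling (domain Q) T) :
    ∃ P, IsLowerSet P ∧ P ⊆ maxPile Q ∧ Square.toLozenge '' surface (domain Q) P = T := by
  have hO := isTiling_outerSquares hQ hlow
  have hTO := hT.union hO disjoint_compl_right
  rw [Set.union_compl_self] at hTO
  obtain ⟨z, hz, hzT, hfree⟩ :=
    exists_isHeightFunction_excess_eq_zero hQ hlow hTO Set.subset_union_right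
  have hsub : pileBelow z ⊆ maxPile Q := fun p hp k => by
    by_contra hnot
    have hpos : Function.update p k 0 ∈ pileBelow z :=
      hz.isLowerSet_pileBelow (update_le_self_iff.2 (Nat.zero_le _)) hp
    exact (hfree _ k (Function.update_self ..) hnot).not_gt hpos
  have hheight := pileHeight_pileBelow ((finite_maxPile hQ).subset hsub) fun q k hk =>
    excess_nonneg_of_wall hQ hlow hz hfree hk
  refine ⟨pileBelow z, hz.isLowerSet_pileBelow, hsub, ?_⟩
  rw [image_surface_domain hQ hlow hz.isLowerSet_pileBelow hsub, hheight, hzT]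
  exact Set.union_sdiff_cancel_right (hT.disjoint hO disjoint_compl_right).le_bot

theorem bijOn_image_surface_domain (hQ : Q.Finite) (hlow : IsLowerSet Q) :
    Set.BijOn (fun P => Square.toLozenge '' surface (domain Q) P)
      {P | IsPileIn (domain Q) P ∧ IsCompactPile P} {T | IsTiling (domain Q) T} := by
  rw [setOf_isPileIn_domain_and_isCompactPile hQ hlow]
  refine ⟨fun P hP => isTiling_domain hQ hlow hP.1 hP.2, fun P hP P' hP' h => ?_, fun T hT => ?_⟩
  · exact eq_of_image_surface_domain_eq hQ hlow hP.1 hP.2 hP'.1 hP'.2 h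
  · obtain ⟨P, hlowP, hPQ, hPT⟩ := exists_image_surface_domain_eq hQ hlow hT
    exact ⟨P, ⟨hlowP, hPQ⟩, hPT⟩

end Piles

/-! ### Piles that correspond to a tiling are compact -/

theorem mem_hexagon_of_mem_lower_face {p : Cube} {k : Fin 3} {t : Triangle}
    (ht : t ∈ (⟨k, p⟩ : Square).toLozenge.cells) : t ∈ hexagon p :=
  Lozenge.cells_subset_region (Set.mem_range_self k) ht

theorem mem_hexagon_of_mem_upper_face {p : Cube} {k : Fin 3} {t : Triangle}
    (ht : t ∈ (⟨k, p + Pi.single k 1⟩ : Square).toLozenge.cells) : t ∈ hexagon p := by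
  rw [hexagon_eq_region_upper_faces]
  exact Lozenge.cells_subset_region (Set.mem_range_self k) ht

theorem exists_mem_visibleFaces_of_mem {P : Set Cube} (hP : P.Finite) {p : Cube} (hp : p ∈ P)
    {t : Triangle} (ht : t ∈ hexagon p) :
    ∃ s ∈ visibleFaces P, t ∈ s.toLozenge.cells ∧ p < s.corner := by
  obtain ⟨q, hpq, ⟨hq, htq⟩, hmax⟩ :=
    (hP.subset (Set.sep_subset P fun q => t ∈ hexagon q)).exists_le_maximal ⟨hp, ht⟩
  rw [hexagon_eq_region_upper_faces] at htq
  obtain ⟨_, ⟨k, rfl⟩, htk⟩ := Set.mem_iUnion₂.1 htq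
  have hlt : q < q + Pi.single k 1 := (covBy_iff_exists_eq_add_single.2 ⟨k, rfl⟩).lt
  refine ⟨_, ⟨q, hq, rfl, fun hmem => ?_⟩, htk, hpq.trans_lt hlt⟩
  exact hlt.not_ge (hmax ⟨hmem, mem_hexagon_of_mem_lower_face htk⟩ hlt.le)

theorem exists_mem_surface_of_notMem {P Q : Set Cube} (hQ : Q.Finite) (hlow : IsLowerSet Q)
    {p : Cube} (hp : p ∉ P) {t : Triangle} (ht : t ∈ hexagon p) (htD : t ∈ domain Q) :
    ∃ s ∈ surface (domain Q) P, t ∈ s.toLozenge.cells ∧ s.corner ≤ p := by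
  obtain ⟨q, ⟨hqp, hq, htq⟩, hmin⟩ :=
    ((Set.finite_Iic p).subset (Set.sep_subset _ fun q => q ∉ P ∧ t ∈ hexagon q)).exists_minimal
      ⟨p, Set.self_mem_Iic, hp, ht⟩
  obtain ⟨_, ⟨k, rfl⟩, htk⟩ := Set.mem_iUnion₂.1 htq
  refine ⟨⟨k, q⟩, ?_, htk, hqp⟩
  by_cases hk : q k = 0
  · refine Or.inr ⟨?_, hq⟩
    rw [baseSquares_domain hQ hlow]
    exact ⟨hk, mem_of_wall_of_mem_domain hQ hlow hk htk htD⟩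
  · obtain ⟨r, rfl⟩ := exists_eq_add_single hk
    have hlt : r < r + Pi.single k 1 := (covBy_iff_exists_eq_add_single.2 ⟨k, rfl⟩).lt
    refine Or.inl ⟨r, by_contra fun hr => hlt.not_ge ?_, rfl, hq⟩
    exact hmin ⟨hlt.le.trans hqp, hr, mem_hexagon_of_mem_upper_face htk⟩ hlt.le

theorem CorrespondsTo.isLowerSet {P Q : Set Cube} {T : Set Lozenge} (hQ : Q.Finite)
    (hlow : IsLowerSet Q) (hP : P.Finite) (hT : IsTiling (domain Q) T)
    (h : CorrespondsTo (domain Q) P T) : IsLowerSet P := by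
  refine isLowerSet_iff_forall_add_single.2 fun q k hp => by_contra fun hq => ?_
  obtain ⟨t, ht⟩ := (⟨k, q + Pi.single k 1⟩ : Square).toLozenge.cells_nonempty
  obtain ⟨s, hs, hts, hps⟩ :=
    exists_mem_visibleFaces_of_mem hP hp (mem_hexagon_of_mem_lower_face ht)
  have hsT := h.mapsTo (Or.inl hs)
  have htD : t ∈ domain Q := hT.2 ▸ Lozenge.cells_subset_region hsT hts
  obtain ⟨s', hs', hts', hs'q⟩ :=
    exists_mem_surface_of_notMem hQ hlow hq (mem_hexagon_of_mem_upper_face ht) htD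
  obtain rfl : s = s' :=
    h.injOn (Or.inl hs) hs' (hT.1.elim_set hsT (h.mapsTo hs') t hts hts')
  exact (le_self_add.trans_lt hps).not_ge hs'q

/-! ### Flips -/

theorem DownFlip.region_eq {T T' : Set Lozenge} (h : DownFlip T T') : region T' = region T := by
  obtain ⟨v, hv, rfl⟩ := h
  rw [region_union, ← region_hexagon, ← region_union,
    Set.sdiff_union_of_subset (Set.range_subset_iff.2 hv)]

theorem IsPseudoHexagonOf.eq_domain {Q : Set Cube} {D : Set Triangle}
    (h : IsPseudoHexagonOf Q D) : D = domain Q := by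
  obtain ⟨-, -, T₀, hflips, -, rfl⟩ := h
  induction hflips with
  | refl => rfl
  | tail _ hflip ih => rw [hflip.region_eq, ih]

theorem dir_ne_zero : ∀ k, dir k ≠ 0 := by decide

theorem IsHeightFunction.heightTiling_update {z : ℤ × ℤ → ℤ} (hz : IsHeightFunction z)
    (v : ℤ × ℤ) : heightTiling (Function.update z v (z v - 1)) =
      (heightTiling z \ Set.range fun k => (⟨k, v + dir k⟩ : Lozenge)) ∪
        Set.range fun k => (⟨k, v⟩ : Lozenge) := by
  ext ⟨k, w⟩
  obtain ⟨u, rfl⟩ : ∃ u, w = u + dir k := ⟨w - dir k, (sub_add_cancel w _).symm⟩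
  have hle := hz u k
  have hge := hz.le_add_dir u k
  have hne : u + dir k ≠ u := by simp [dir_ne_zero]
  simp only [mem_heightTiling_iff, Set.mem_union, Set.mem_sdiff, Set.mem_range, Lozenge.mk.injEq,
    exists_eq_left, add_left_inj]
  rcases eq_or_ne u v with rfl | hu
  · simp only [Function.update_self, Function.update_of_ne hne, hne.symm, not_true, and_false,
      or_false, iff_false]
    omega
  rcases eq_or_ne v (u + dir k) with rfl | hv
  · simp only [Function.update_self, Function.update_of_ne hu, or_true, iff_true]
    omega
  · simp only [Function.update_of_ne hu, Function.update_of_ne hv.symm, hu.symm, hv,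
      not_false_eq_true, and_true, or_false]

theorem IsHeightFunction.downFlip_sdiff {z : ℤ × ℤ → ℤ} (hz : IsHeightFunction z) {v : ℤ × ℤ}
    (hv : ∀ k, (⟨k, v + dir k⟩ : Lozenge) ∈ heightTiling z) {O : Set Lozenge}
    (hO : O ⊆ heightTiling z) (hO' : O ⊆ heightTiling (Function.update z v (z v - 1))) :
    DownFlip (heightTiling z \ O) (heightTiling (Function.update z v (z v - 1)) \ O) := by
  rw [hz.heightTiling_update] at hO' ⊢
  have hup (k) : (⟨k, v + dir k⟩ : Lozenge) ∉ O := fun hk => by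
    rcases hO' hk with ⟨-, hmem⟩ | ⟨j, hj⟩
    · exact hmem (Set.mem_range_self k)
    · simp [dir_ne_zero] at hj
  have hdown : Disjoint (Set.range fun k => (⟨k, v⟩ : Lozenge)) O := by
    refine Set.disjoint_left.2 ?_
    rintro _ ⟨j, rfl⟩ hj
    have hne : j + 1 ≠ j := by simp
    exact (mem_heightTiling_iff.1 (hv (j + 1))).ne
      (hz.eq_add_rise_of_mem_heightTiling (hO hj) hne)
  refine ⟨v, fun k => ⟨hv k, hup k⟩, ?_⟩
  rw [Set.union_sdiff_distrib, hdown.sdiff_eq_left, sdiff_right_comm]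

theorem isLowerSet_sdiff_singleton {α : Type*} [PartialOrder α] {s : Set α} (hs : IsLowerSet s)
    {a : α} (ha : Maximal (· ∈ s) a) : IsLowerSet (s \ {a}) :=
  hs.sdiff fun _ hb _ hc hcb => by
    obtain rfl := hc
    exact ha.eq_of_ge hb hcb

section Piles

variable {P Q : Set Cube}

theorem pileHeight_sdiff_singleton (hP : P.Finite) (hlow : IsLowerSet P) {p : Cube}
    (hp : Maximal (· ∈ P) p) : pileHeight (P \ {p}) =
      Function.update (pileHeight P) (proj p) (pileHeight P (proj p) - 1) := by
  ext v
  rcases eq_or_ne v (proj p) with rfl | hv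
  · rw [Function.update_self]
    have hsucc : p + 1 ∉ P := fun h => by simpa using hp.2 h le_self_add 0
    have hle : pileHeight P (proj p) ≤ p 2 + 1 := by
      simpa [proj_add_one] using pileHeight_le hsucc
    have hlt := (mem_iff_lt_pileHeight hP hlow).1 hp.1
    have hle' : pileHeight (P \ {p}) (proj p) ≤ p 2 := pileHeight_le fun h => h.2 rfl
    obtain ⟨q, hq, hqp, hq₂⟩ := exists_notMem_eq_pileHeight (hP.sdiff (t := {p})) (proj p)
    rcases eq_or_ne q p with rfl | hne
    · omega
    · have hge := pileHeight_le fun h : q ∈ P => hq ⟨h, hne⟩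
      rw [hqp] at hge
      omega
  · rw [Function.update_of_ne hv, pileHeight, pileHeight]
    congr 1
    ext t
    refine exists_congr fun q => ?_
    simp only [Set.mem_sdiff, Set.mem_singleton_iff]
    grind

theorem downFlip_image_surface_domain (hQ : Q.Finite) (hlowQ : IsLowerSet Q)
    (hlow : IsLowerSet P) (hPQ : P ⊆ maxPile Q) {p : Cube} (hp : Maximal (· ∈ P) p) :
    DownFlip (Square.toLozenge '' surface (domain Q) P)
      (Square.toLozenge '' surface (domain Q) (P \ {p})) := by
  have hP := (finite_maxPile hQ).subset hPQ
  have hlow' := isLowerSet_sdiff_singleton hlow hp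
  have hPQ' : P \ {p} ⊆ maxPile Q := Set.sdiff_subset.trans hPQ
  have hO' := image_outerSquares_subset_heightTiling hQ hlowQ hlow' hPQ'
  rw [image_surface_domain hQ hlowQ hlow hPQ, image_surface_domain hQ hlowQ hlow' hPQ']
  rw [pileHeight_sdiff_singleton hP hlow hp] at hO' ⊢
  refine (isHeightFunction_pileHeight hP hlow).downFlip_sdiff (fun k => ?_)
    (image_outerSquares_subset_heightTiling hQ hlowQ hlow hPQ) hO'
  rw [← (bijOn_toLozenge_surface_univ hP hlow).image_eq, ← proj_add_single]
  refine ⟨⟨k, p + Pi.single k 1⟩, Or.inl ⟨p, hp.1, rfl, fun h => ?_⟩, rfl⟩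
  simpa using hp.2 h le_self_add k

theorem reflTransGen_downFlip (hQ : Q.Finite) (hlowQ : IsLowerSet Q) (hlow : IsLowerSet P)
    (hPQ : P ⊆ maxPile Q) :
    Relation.ReflTransGen DownFlip (Square.toLozenge '' surface (domain Q) P)
      (Square.toLozenge '' surface (domain Q) ∅) := by
  have hP := (finite_maxPile hQ).subset hPQ
  induction hn : P.ncard generalizing P with
  | zero => rw [(Set.ncard_eq_zero hP).1 hn]
  | succ n ih =>
    obtain ⟨p, hp⟩ := hP.exists_maximal (Set.nonempty_of_ncard_ne_zero (by omega))
    refine .head (downFlip_image_surface_domain hQ hlowQ hlow hPQ hp)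
      (ih (isLowerSet_sdiff_singleton hlow hp) (Set.sdiff_subset.trans hPQ) hP.sdiff ?_)
    rw [Set.ncard_sdiff_singleton_of_mem hp.1, hn, Nat.add_sub_cancel]

theorem exists_axis_mem_heightTiling_empty (v : ℤ × ℤ) :
    ∃ j, (⟨j, v⟩ : Lozenge) ∈ heightTiling (pileHeight ∅) := by
  obtain ⟨q, hq, rfl, hq₂⟩ := exists_notMem_eq_pileHeight Set.finite_empty v
  obtain ⟨j, hj⟩ : ∃ j, q j = 0 := by
    by_contra! hpos
    obtain ⟨r, rfl⟩ := exists_eq_add_one hpos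
    have hle := pileHeight_le (Set.notMem_empty r)
    simp only [proj_add_one, Pi.add_apply, Pi.one_apply, Nat.cast_add, Nat.cast_one] at hq₂
    omega
  refine ⟨j, ?_⟩
  rw [← (bijOn_toLozenge_surface_univ Set.finite_empty isLowerSet_empty).image_eq]
  exact ⟨⟨j, q⟩, outerSquares_subset_surface_univ ∅ ⟨hj, hq⟩, rfl⟩

theorem not_downFlip_image_surface_empty (hQ : Q.Finite) (hlow : IsLowerSet Q)
    (T : Set Lozenge) : ¬ DownFlip (Square.toLozenge '' surface (domain Q) ∅) T := by
  rintro ⟨v, hv, -⟩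
  rw [image_surface_domain hQ hlow isLowerSet_empty (Set.empty_subset _)] at hv
  obtain ⟨j, hj⟩ := exists_axis_mem_heightTiling_empty v
  have hz := isHeightFunction_pileHeight Set.finite_empty isLowerSet_empty
  have hne : j + 1 ≠ j := by simp
  exact (mem_heightTiling_iff.1 (hv (j + 1)).1).ne (hz.eq_add_rise_of_mem_heightTiling hj hne)

theorem surface_domain_maxPile (hQ : Q.Finite) (hlow : IsLowerSet Q) :
    surface (domain Q) (maxPile Q) = visibleFaces (maxPile Q) := by
  rw [surface_domain hQ hlow, surface_univ, outerSquares_maxPile hlow, Set.union_sdiff_right,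
    (disjoint_visibleFaces_outerSquares _ Q).sdiff_eq_left]

theorem isPseudoHexagonOf_maxPile (hQ : Q.Finite) (hlow : IsLowerSet Q) :
    IsPseudoHexagonOf (maxPile Q) (domain Q) := by
  have hlow' := isLowerSet_maxPile hlow
  refine ⟨finite_maxPile hQ, isCompactPile_iff_isLowerSet.2 hlow', _, ?_,
    not_downFlip_image_surface_empty hQ hlow,
    (isTiling_domain hQ hlow isLowerSet_empty (Set.empty_subset _)).2.symm⟩
  rw [← surface_domain_maxPile hQ hlow]
  exact reflTransGen_downFlip hQ hlow hlow' subset_rfl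

theorem isGreatest_maxPile (hQ : Q.Finite) (hlow : IsLowerSet Q) :
    IsGreatest {P | IsPileIn (domain Q) P ∧ IsCompactPile P} (maxPile Q) := by
  rw [setOf_isPileIn_domain_and_isCompactPile hQ hlow]
  exact ⟨⟨isLowerSet_maxPile hlow, subset_rfl⟩, fun _ hP => hP.2⟩

end Piles

/-! ### Ferrers diagrams and plane partitions -/

theorem IsFerrersDiagram.isLowerSet {S : Set (ℕ × ℕ)} (h : IsFerrersDiagram S) :
    IsLowerSet S := by
  obtain ⟨l, hl, -, rfl⟩ := h
  rintro ⟨i', j'⟩ ⟨i, j⟩ ⟨hi, hj⟩ (hmem : j' < l.getD i' 0)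
  have hi' : i' < l.length := by
    by_contra! hlen
    rw [List.getD_eq_default _ _ hlen] at hmem
    exact Nat.not_lt_zero _ hmem
  rw [List.getD_eq_getElem _ _ hi'] at hmem
  have hrow : l[i'] ≤ l[i] := hl.rel_get_of_le (a := ⟨i, hi.trans_lt hi'⟩) (b := ⟨i', hi'⟩) hi
  change j < l.getD i 0
  rw [List.getD_eq_getElem _ _ (hi.trans_lt hi')]
  exact hj.trans_lt (hmem.trans_le hrow)

theorem IsFerrersDiagram.finite {S : Set (ℕ × ℕ)} (h : IsFerrersDiagram S) : S.Finite := by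
  have hlow := h.isLowerSet
  obtain ⟨l, -, -, rfl⟩ := h
  refine (Set.finite_Iic (l.length, l.getD 0 0)).subset fun c hc => ⟨?_, ?_⟩
  · by_contra! hlen
    rw [Set.mem_ofPred_eq, List.getD_eq_default _ _ hlen.le] at hc
    exact Nat.not_lt_zero _ hc
  · exact (hlow (Prod.mk_le_mk.2 ⟨Nat.zero_le c.1, le_rfl⟩) hc).le

theorem isFerrersDiagram_iff {S : Set (ℕ × ℕ)} :
    IsFerrersDiagram S ↔ S.Finite ∧ IsLowerSet S := by
  refine ⟨fun h => ⟨h.finite, h.isLowerSet⟩, fun ⟨hS, hlow⟩ => ?_⟩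
  let μ : YoungDiagram := ⟨hS.toFinset, by simpa using hlow⟩
  have hmem (c : ℕ × ℕ) : c ∈ S ↔ c ∈ μ := by simp [μ, ← YoungDiagram.mem_cells]
  refine ⟨μ.rowLens, μ.rowLens_sorted.pairwise, fun x => μ.pos_of_mem_rowLens x, ?_⟩
  ext ⟨i, j⟩
  rw [hmem, YoungDiagram.mem_iff_lt_rowLen, Set.mem_ofPred_eq]
  rcases lt_or_ge i μ.rowLens.length with hi | hi
  · rw [List.getD_eq_getElem _ _ hi, YoungDiagram.get_rowLens]
  · rw [List.getD_eq_default _ _ hi, ← YoungDiagram.mem_iff_lt_rowLen,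
      YoungDiagram.mem_iff_lt_colLen]
    rw [YoungDiagram.length_rowLens] at hi
    have := μ.colLen_anti 0 j (Nat.zero_le _)
    omega

section Layers

variable {P : Set Cube}

theorem isLowerSet_layer (hlow : IsLowerSet P) (k : Fin 3) (n : ℕ) :
    IsLowerSet (layer P k n) := by
  rintro ⟨_, _⟩ ⟨a, b⟩ ⟨ha, hb⟩ ⟨p, hp, hk, rfl, rfl⟩
  have hne : k ≠ k + 1 ∧ k ≠ k + 2 ∧ k + 1 ≠ k + 2 := by clear * -; decide +revert
  refine ⟨Function.update (Function.update p (k + 1) a) (k + 2) b, hlow ?_ hp, ?_⟩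
  · exact (update_le_self_iff.2 (by simpa [hne] using hb)).trans (update_le_self_iff.2 ha)
  · simp [hne, hk]

theorem finite_layer (hP : P.Finite) (k : Fin 3) (n : ℕ) : (layer P k n).Finite :=
  (hP.image fun p => (p (k + 1), p (k + 2))).subset fun _ ⟨p, hp, _, h₁, h₂⟩ =>
    ⟨p, hp, Prod.ext h₁ h₂⟩

theorem isCompactPile_of_isLowerSet_layer (h : ∀ k n, IsLowerSet (layer P k n)) :
    IsCompactPile P := by
  intro p hp k i hi
  obtain ⟨l, rfl⟩ : ∃ l : Fin 3, k = l + 2 := ⟨k - 2, (sub_add_cancel k 2).symm⟩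
  obtain ⟨q, hq, h₀, h₁, h₂⟩ := h l (p l) (show (p (l + 1), i) ≤ (p (l + 1), p (l + 2)) from
    ⟨le_rfl, hi⟩) ⟨p, hp, rfl, rfl, rfl⟩
  have hne : l ≠ l + 2 ∧ l + 1 ≠ l + 2 := by clear * -; decide +revert
  convert hq using 1
  ext j
  obtain rfl | rfl | rfl : j = l ∨ j = l + 1 ∨ j = l + 2 := by clear * -; decide +revert
  · simp [hne, h₀]
  · simp [hne, h₁]
  · simp [h₂]

theorem isCompactPile_iff_forall_isFerrersDiagram_layer (hP : P.Finite) :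
    IsCompactPile P ↔ ∀ k n, IsFerrersDiagram (layer P k n) :=
  ⟨fun h k n => isFerrersDiagram_iff.2 ⟨finite_layer hP k n,
      isLowerSet_layer (isCompactPile_iff_isLowerSet.1 h) k n⟩,
    fun h => isCompactPile_of_isLowerSet_layer fun k n => (h k n).isLowerSet⟩

end Layers

namespace PlanePartition

theorem mem_shape_iff (A : PlanePartition) {i j : ℕ} : (i, j) ∈ A.shape ↔ 0 < A.entry i j :=
  ⟨A.entry_pos i j, fun h => by
    by_contra hnot
    exact h.ne' (A.entry_zero i j hnot)⟩

theorem entry_anti (A : PlanePartition) {i i' j j' : ℕ} (hi : i ≤ i') (hj : j ≤ j') :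
    A.entry i' j' ≤ A.entry i j := by
  by_cases h : (i', j') ∈ A.shape
  · have hlow := A.shape_ferrers.isLowerSet
    have hrow : (i, j') ∈ A.shape := hlow (Prod.mk_le_mk.2 ⟨hi, le_rfl⟩) h
    have hcorner : (i, j) ∈ A.shape := hlow (Prod.mk_le_mk.2 ⟨le_rfl, hj⟩) hrow
    exact (A.col_le _ _ _ hrow h hi).trans (A.row_le _ _ _ hcorner hrow hj)
  · simp [A.entry_zero _ _ h]

theorem isLowerSet_pile (A : PlanePartition) : IsLowerSet A.pile :=
  fun p _ hqp (hp : p 2 < _) => (hqp 2).trans_lt (hp.trans_le (A.entry_anti (hqp 0) (hqp 1)))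

theorem finite_pile (A : PlanePartition) : A.pile.Finite := by
  obtain ⟨M, hM⟩ := A.shape_ferrers.finite.bddAbove
  refine (Set.finite_Iic ![M.1, M.2, A.entry 0 0]).subset fun p (hp : p 2 < _) k => ?_
  have hle := hM (A.mem_shape_iff.2 (Nat.zero_lt_of_lt hp))
  fin_cases k
  exacts [hle.1, hle.2, hp.le.trans (A.entry_anti (Nat.zero_le _) (Nat.zero_le _))]

theorem pile_subset_pile_iff {A B : PlanePartition} : A.pile ⊆ B.pile ↔ A.BoundedBy B := by
  refine ⟨fun h i j => ?_, fun h p (hp : p 2 < _) => hp.trans_le (h _ _)⟩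
  by_contra! hlt
  exact lt_irrefl (B.entry i j) (@h ![i, j, B.entry i j] hlt)

theorem entry_injective : Function.Injective entry := by
  intro A B h
  have hshape : A.shape = B.shape := by
    ext ⟨i, j⟩
    rw [mem_shape_iff, mem_shape_iff, h]
  cases A
  cases B
  congr

theorem pile_injective : Function.Injective pile := fun _ _ h =>
  entry_injective <| funext₂ fun i j =>
    le_antisymm (pile_subset_pile_iff.1 h.le i j) (pile_subset_pile_iff.1 h.ge i j)

end PlanePartition

/-- The number of cubes of a compact pile on the square `(i, j)` of the horizontal wall, encoded as
the least height at which there is no cube. -/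
noncomputable def columnHeight (P : Set Cube) (i j : ℕ) : ℕ := sInf {t | ![i, j, t] ∉ P}

section Columns

variable {P : Set Cube}

theorem lt_columnHeight_iff (hP : P.Finite) (hlow : IsLowerSet P) {i j t : ℕ} :
    t < columnHeight P i j ↔ ![i, j, t] ∈ P := by
  refine ⟨fun h => not_not.1 (Nat.notMem_of_lt_sInf h), fun h => ?_⟩
  obtain ⟨M, hM⟩ := hP.bddAbove
  have hnonempty : {t | ![i, j, t] ∉ P}.Nonempty :=
    ⟨M 2 + 1, fun hmem => (hM hmem 2).not_gt (Nat.lt_succ_self _)⟩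
  by_contra! hle
  refine Nat.sInf_mem hnonempty (hlow (fun k => ?_) h)
  fin_cases k
  exacts [le_rfl, le_rfl, hle]

theorem columnHeight_anti (hP : P.Finite) (hlow : IsLowerSet P) {i i' j j' : ℕ} (hi : i ≤ i')
    (hj : j ≤ j') : columnHeight P i' j' ≤ columnHeight P i j := by
  refine le_of_forall_lt fun t ht => ?_
  rw [lt_columnHeight_iff hP hlow] at ht ⊢
  refine hlow (fun k => ?_) ht
  fin_cases k
  exacts [hi, hj, le_rfl]

theorem vec_eq_of_apply_two_eq {p : Cube} {t : ℕ} (ht : p 2 = t) : ![p 0, p 1, t] = p := by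
  subst ht
  ext k
  fin_cases k <;> rfl

theorem layer_two_zero (hP : P.Finite) (hlow : IsLowerSet P) :
    layer P 2 0 = {c | 0 < columnHeight P c.1 c.2} := by
  ext ⟨i, j⟩
  rw [Set.mem_ofPred_eq, lt_columnHeight_iff hP hlow]
  refine ⟨?_, fun h => ⟨_, h, rfl, rfl, rfl⟩⟩
  rintro ⟨p, hp, h₂, rfl, rfl⟩
  exact (vec_eq_of_apply_two_eq h₂).symm ▸ hp

theorem PlanePartition.exists_pile_eq (hP : P.Finite) (hlow : IsLowerSet P) :
    ∃ A : PlanePartition, A.pile = P := by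
  let A : PlanePartition :=
    { shape := {c | 0 < columnHeight P c.1 c.2}
      shape_ferrers := layer_two_zero hP hlow ▸
        isFerrersDiagram_iff.2 ⟨finite_layer hP 2 0, isLowerSet_layer hlow 2 0⟩
      entry := columnHeight P
      entry_pos := fun _ _ h => h
      entry_zero := fun _ _ h => Nat.eq_zero_of_not_pos h
      row_le := fun _ _ _ _ _ h => columnHeight_anti hP hlow le_rfl h
      col_le := fun _ _ _ _ _ h => columnHeight_anti hP hlow h le_rfl }
  refine ⟨A, Set.ext fun p => ?_⟩
  change p 2 < columnHeight P (p 0) (p 1) ↔ p ∈ P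
  rw [lt_columnHeight_iff hP hlow, vec_eq_of_apply_two_eq rfl]

end Columns

theorem PlanePartition.bijOn_pile (B : PlanePartition) :
    Set.BijOn pile {A | A.BoundedBy B} {P | IsLowerSet P ∧ P ⊆ B.pile} := by
  refine ⟨fun A hA => ⟨A.isLowerSet_pile, pile_subset_pile_iff.2 hA⟩, pile_injective.injOn, ?_⟩
  rintro P ⟨hlow, hP⟩
  obtain ⟨A, rfl⟩ := exists_pile_eq (B.finite_pile.subset hP) hlow
  exact ⟨A, pile_subset_pile_iff.1 hP, rfl⟩

end LozengeTiling

open LozengeTiling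

theorem mainTheorem5 (D : Set LozengeTiling.Triangle) (hD : LozengeTiling.IsPseudoHexagon D) :
    -- a pile in the pseudo-hexagon corresponds to a tiling if and only if it is compact
    (∀ P : Set LozengeTiling.Cube, LozengeTiling.IsPileIn D P →
      ((∃ T, LozengeTiling.IsTiling D T ∧ LozengeTiling.CorrespondsTo D P T) ↔
        LozengeTiling.IsCompactPile P)) ∧
    -- compact means that all sections orthogonal to an axis are Ferrers diagrams
    (∀ P : Set LozengeTiling.Cube, P.Finite →
      (LozengeTiling.IsCompactPile P ↔
        ∀ (k : Fin 3) (n : ℕ), LozengeTiling.IsFerrersDiagram (LozengeTiling.layer P k n))) ∧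
    -- the empty pile corresponds to the minimal tiling
    (∃ T₀, LozengeTiling.IsTiling D T₀ ∧ LozengeTiling.CorrespondsTo D ∅ T₀ ∧
      ∀ T', ¬ LozengeTiling.DownFlip T₀ T') ∧
    -- tilings correspond bijectively to the plane partitions bounded by a given one
    (∃ B : LozengeTiling.PlanePartition,
      LozengeTiling.IsPseudoHexagonOf B.pile D ∧
      IsGreatest {P | LozengeTiling.IsPileIn D P ∧ LozengeTiling.IsCompactPile P} B.pile ∧
      Set.BijOn LozengeTiling.PlanePartition.pile
        {A | A.BoundedBy B}
        {P | LozengeTiling.IsPileIn D P ∧ LozengeTiling.IsCompactPile P} ∧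
      ∃ f : {A : LozengeTiling.PlanePartition // A.BoundedBy B} ≃
          {T : Set LozengeTiling.Lozenge // LozengeTiling.IsTiling D T},
        ∀ A, LozengeTiling.CorrespondsTo D A.1.pile (f A).1) := by
  obtain ⟨Q, hQD⟩ := hD
  obtain rfl := hQD.eq_domain
  have hQ : Q.Finite := hQD.1
  have hlow : IsLowerSet Q := isCompactPile_iff_isLowerSet.1 hQD.2.1
  obtain ⟨B, hB⟩ := PlanePartition.exists_pile_eq (finite_maxPile hQ) (isLowerSet_maxPile hlow)
  have hpile : Set.BijOn PlanePartition.pile {A | A.BoundedBy B}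
      {P | IsPileIn (domain Q) P ∧ IsCompactPile P} := by
    rw [setOf_isPileIn_domain_and_isCompactPile hQ hlow, ← hB]
    exact B.bijOn_pile
  have htiling := bijOn_image_surface_domain hQ hlow
  have hcorr {P : Set Cube} (hP : IsPileIn (domain Q) P ∧ IsCompactPile P) :=
    correspondsTo_image_surface_domain hQ hlow hP.1 hP.2
  have hempty : IsPileIn (domain Q) ∅ ∧ IsCompactPile ∅ := by
    simp [IsPileIn, IsCompactPile]
  refine ⟨fun P hP => ⟨?_, fun hc => ⟨_, htiling.mapsTo ⟨hP, hc⟩, hcorr ⟨hP, hc⟩⟩⟩,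
    fun P hP => isCompactPile_iff_forall_isFerrersDiagram_layer hP,
    ⟨_, htiling.mapsTo hempty, hcorr hempty, not_downFlip_image_surface_empty hQ hlow⟩,
    B, hB ▸ isPseudoHexagonOf_maxPile hQ hlow, hB ▸ isGreatest_maxPile hQ hlow, hpile,
    (htiling.comp hpile).equiv, fun A => hcorr (hpile.mapsTo A.2)⟩
  rintro ⟨T, hT, hPT⟩
  exact isCompactPile_iff_isLowerSet.2 (hPT.isLowerSet hQ hlow hP.1 hT)
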